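/- For a positive integer $D$ put $\beta_D=\dfrac{\Gamma(D/2)}{\sqrt{\pi}\,\Gamma((D+1)/2)}$. For real matrices $X,Y$ of the same size let $\langle X,Y\rangle_F=\operatorname{tr}(X^\top Y)$, $\|X\|_F=\sqrt{\langle X,X\rangle_F}$ and $\cos(X,Y)=\dfrac{\langle X,Y\rangle_F}{\|X\|_F\,\|Y\|_F}$. Let $G\in\mathbb{R}^{d_{\mathrm{out}}\times d_{\mathrm{in}}}$ be a fixed nonzero matrix (the true gradient), and let $R$ be a random $d_{\mathrm{out}}\times d_{\mathrm{in}}$ matrix with i.i.d. $\mathcal N(0,1)$ entries. Let $$\widehat G^{\mathrm{MEZO}}_0=\langle G,R\rangle_F\,R$$ be the noiseless MeZO estimator, which, for every function $f$ on $\mathbb{R}^{d_{\mathrm{out}}\times d_{\mathrm{in}}}$ with gradient $G$ at $W$, is the limit as $\mu\to 0^+$ of the finite-difference estimator $\frac{f(W+\mu R)-f(W)}{\mu}\,R$. Then $\cos(\widehat G^{\mathrm{MEZO}}_0,G)$ is integrable and $$\mathbb{E}_R\big[\cos(\widehat G^{\mathrm{MEZO}}_0,G)\big]=\beta_{d_{\mathrm{out}}d_{\mathrm{in}}}.$$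 Moreover $\widehat G^{\mathrm{MEZO}}_0$ is the special case $A=I_{d_{\mathrm{in}}}$ (a matrix with orthonormal columns) of the noiseless AGZO estimator $\langle G,RA^\top\rangle_F\,RA^\top$, and for this $A$ one has $\|GA\|_F/\|G\|_F=1$. -/

import Mathlib

open MeasureTheory ProbabilityTheory Filter Topology

noncomputable section

/-- Frobenius inner product `⟨X, Y⟩_F = tr(Xᵀ Y)`. -/
def frobInner {m n : ℕ} (X Y : Matrix (Fin m) (Fin n) ℝ) : ℝ :=
  (X.transpose * Y).trace

/-- Frobenius norm `‖X‖_F = √⟨X, X⟩_F`. -/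
def frobNorm {m n : ℕ} (X : Matrix (Fin m) (Fin n) ℝ) : ℝ :=
  Real.sqrt (frobInner X X)

/-- Cosine similarity `⟨X, Y⟩_F / (‖X‖_F ‖Y‖_F)` of two matrices. -/
def cosSim {m n : ℕ} (X Y : Matrix (Fin m) (Fin n) ℝ) : ℝ :=
  frobInner X Y / (frobNorm X * frobNorm Y)

/-- `β_D = Γ(D/2) / (√π Γ((D+1)/2))`. -/
def betaConst (D : ℕ) : ℝ :=
  Real.Gamma ((D : ℝ) / 2) / (Real.sqrt Real.pi * Real.Gamma (((D : ℝ) + 1) / 2))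

/-- `G` is the gradient of the loss `f` at the weights `W` with respect to the Frobenius inner
product: the derivative of `f` at `W` in each direction `Δ` exists and equals `⟨G, Δ⟩_F`. -/
def HasMatrixGradientAt {m n : ℕ} (f : Matrix (Fin m) (Fin n) ℝ → ℝ)
    (G W : Matrix (Fin m) (Fin n) ℝ) : Prop :=
  ∀ Δ : Matrix (Fin m) (Fin n) ℝ, HasLineDerivAt ℝ f (frobInner G Δ) W Δ

/-- The finite-difference MeZO estimator `((f(W + μ R) - f(W)) / μ) R` with smoothing
parameter `μ` and direction `R`. -/
def mezoEstimator {m n : ℕ} (f : Matrix (Fin m) (Fin n) ℝ → ℝ)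
    (W : Matrix (Fin m) (Fin n) ℝ) (μ : ℝ) (R : Matrix (Fin m) (Fin n) ℝ) :
    Matrix (Fin m) (Fin n) ℝ :=
  ((f (W + μ • R) - f W) / μ) • R

/-- The noiseless AGZO estimator `⟨G, R Aᵀ⟩_F R Aᵀ`. -/
def agzoNoiseless {m n r : ℕ} (G : Matrix (Fin m) (Fin n) ℝ) (A : Matrix (Fin n) (Fin r) ℝ)
    (R : Matrix (Fin m) (Fin r) ℝ) : Matrix (Fin m) (Fin n) ℝ :=
  frobInner G (R * A.transpose) • (R * A.transpose)

/-- The noiseless MeZO estimator `⟨G, R⟩_F R`: the finite difference is replaced by the exact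
directional derivative. -/
def mezoNoiseless {m n : ℕ} (G R : Matrix (Fin m) (Fin n) ℝ) : Matrix (Fin m) (Fin n) ℝ :=
  frobInner G R • R

/-- `R` is a random matrix whose entries are independent standard normal variables. -/
def IsStdGaussianMatrix {m n : ℕ} {Ω : Type*} [MeasurableSpace Ω] (P : Measure Ω)
    (R : Ω → Matrix (Fin m) (Fin n) ℝ) : Prop :=
  (∀ i j, HasLaw (fun ω => R ω i j) (gaussianReal 0 1) P) ∧
    iIndepFun (fun (p : Fin m × Fin n) (ω : Ω) => R ω p.1 p.2) P

end

/-! The scalar `⟨G, R⟩` cancels from the cosine up to its sign, so the cosine is `|⟨u, x⟩| / ‖x‖`,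
with `u = G / ‖G‖` and `x` standard Gaussian in dimension `D = m * n`. Write `1 / ‖x‖ = Γ(1/2)⁻¹ ∫
s^(-1/2) e^(-s‖x‖²) ds` and swap integrals: for fixed `s` the Gaussian mean factors over an
orthonormal basis containing `u`, giving `√(2/π) (1+2s)^(-(D+1)/2)`. The remaining Beta-type
integral in `s` yields `betaConst D`. Working with `∫⁻`, Tonelli needs no integrability, and the
finite value then gives it. -/

/-- The Gamma integral `∫ t^(a-1) e^(-rt) dt = Γ(a) r^(-a)` as a lower Lebesgue integral. -/
lemma lintegral_rpow_mul_exp_neg_mul_Ioi {a r : ℝ} (ha : 0 < a) (hr : 0 < r) :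
    ∫⁻ t in Set.Ioi (0 : ℝ), ENNReal.ofReal (t ^ (a - 1) * Real.exp (-(r * t))) =
      ENNReal.ofReal ((1 / r) ^ a * Real.Gamma a) := by
  have hpos : 0 < (1 / r) ^ a * Real.Gamma a :=
    mul_pos (Real.rpow_pos_of_pos (by positivity) _) (Real.Gamma_pos_of_pos ha)
  rw [← Real.integral_rpow_mul_exp_neg_mul_Ioi ha hr] at hpos ⊢
  refine (ofReal_integral_eq_lintegral_ofReal ?_ ?_).symm
  -- A non-integrable function has Bochner integral `0`, so a positive value forces integrability.
  · by_contra h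
    exact hpos.ne' (integral_undef h)
  · filter_upwards [ae_restrict_mem measurableSet_Ioi] with t ht
    have : 0 < t := ht
    positivity

/-- The Laplace transform of the squared modulus of a standard normal variable. -/
lemma integral_exp_neg_mul_sq_gaussianReal {s : ℝ} (hs : 0 < s) :
    ∫ x, Real.exp (-(s * x ^ 2)) ∂gaussianReal 0 1 = (1 + 2 * s) ^ (-(1 / 2) : ℝ) := by
  rw [integral_gaussianReal_eq_integral_smul one_ne_zero]
  have h : ∀ x : ℝ, gaussianPDFReal 0 1 x • Real.exp (-(s * x ^ 2)) =
      (√(2 * Real.pi))⁻¹ * Real.exp (-(s + 1 / 2) * x ^ 2) := by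
    intro x
    simp only [gaussianPDFReal, NNReal.coe_one, mul_one, sub_zero, smul_eq_mul]
    rw [mul_assoc, ← Real.exp_add]
    ring_nf
  simp_rw [h]
  rw [integral_const_mul, integral_gaussian, Real.rpow_neg (by positivity), ← Real.sqrt_eq_rpow,
    ← Real.sqrt_inv, ← Real.sqrt_mul (by positivity), ← Real.sqrt_inv]
  congr 1
  have := Real.pi_pos
  field_simp
  ring

/-- The first absolute moment of a standard normal variable, weighted by `exp (-s x²)`. -/
lemma integral_abs_mul_exp_neg_mul_sq_gaussianReal {s : ℝ} (hs : 0 < s) :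
    ∫ x, |x| * Real.exp (-(s * x ^ 2)) ∂gaussianReal 0 1 =
      √(2 / Real.pi) * (1 + 2 * s)⁻¹ := by
  rw [integral_gaussianReal_eq_integral_smul one_ne_zero]
  have h : ∀ x : ℝ, gaussianPDFReal 0 1 x • (|x| * Real.exp (-(s * x ^ 2))) =
      (√(2 * Real.pi))⁻¹ * (|x| * Real.exp (-(s + 1 / 2) * |x| ^ 2)) := by
    intro x
    simp only [gaussianPDFReal, NNReal.coe_one, mul_one, sub_zero, smul_eq_mul, sq_abs]
    rw [show -(s + 1 / 2) * x ^ 2 = -x ^ 2 / 2 + -(s * x ^ 2) by ring, Real.exp_add]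
    ring
  simp_rw [h]
  have h1 : ∫ x in Set.Ioi (0 : ℝ), x * Real.exp (-(s + 1 / 2) * x ^ 2) = (1 + 2 * s)⁻¹ := by
    have := integral_rpow_mul_exp_neg_mul_rpow (p := 2) (q := 1) (b := s + 1 / 2)
      (by norm_num) (by norm_num) (by positivity)
    norm_num [Real.rpow_neg_one] at this
    norm_num
    rw [this]
    field_simp
    ring
  rw [integral_const_mul, integral_comp_abs (f := fun x => x * Real.exp (-(s + 1 / 2) * x ^ 2)), h1,
    ← mul_assoc]
  congr 1
  have h2 : √2 * √2 = 2 := Real.mul_self_sqrt (by norm_num)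
  have := Real.pi_pos
  rw [Real.sqrt_mul (by norm_num), Real.sqrt_div (by norm_num)]
  field_simp
  linarith

/-! ### Mean absolute cosine of a standard Gaussian vector -/

section StdGaussian

variable {ι : Type*} [Fintype ι]

lemma exists_orthonormalBasis_apply_eq (i₀ : ι) {u : EuclideanSpace ℝ ι} (hu : ‖u‖ = 1) :
    ∃ b : OrthonormalBasis ι ℝ (EuclideanSpace ℝ ι), b i₀ = u := by
  have hv : Orthonormal ℝ (({i₀} : Set ι).domRestrict fun _ => u) :=
    ⟨fun _ => hu, fun i j hij => (hij (Subsingleton.elim i j)).elim⟩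
  obtain ⟨b, hb⟩ := hv.exists_orthonormalBasis_extension_of_card_eq (by simp)
  exact ⟨b, hb i₀ rfl⟩

/-- By rotation invariance `u` may be a basis vector. Its coordinate contributes `√(2/π) (1+2s)⁻¹`
and each of the other `D - 1` contributes `(1+2s)^(-1/2)`. -/
lemma integral_abs_inner_mul_exp_stdGaussian [Nonempty ι] {u : EuclideanSpace ℝ ι}
    (hu : ‖u‖ = 1) {s : ℝ} (hs : 0 < s) :
    ∫ x, |inner ℝ u x| * Real.exp (-(‖x‖ ^ 2 * s)) ∂stdGaussian (EuclideanSpace ℝ ι) =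
      √(2 / Real.pi) * (1 / (1 + 2 * s)) ^ (((Fintype.card ι : ℝ) + 1) / 2) := by
  classical
  obtain ⟨i₀⟩ := ‹Nonempty ι›
  obtain ⟨b, rfl⟩ := exists_orthonormalBasis_apply_eq i₀ hu
  have hb : ∀ y : ι → ℝ, ∑ i, y i • b i = b.repr.symm (WithLp.toLp 2 y) := fun y => by
    simp [b.sum_repr_symm]
  have hint : ∀ y : ι → ℝ, |inner ℝ (b i₀) (∑ i, y i • b i)| *
      Real.exp (-(‖∑ i, y i • b i‖ ^ 2 * s)) =
      ∏ i, (if i = i₀ then |y i| else 1) * Real.exp (-(s * y i ^ 2)) := by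
    intro y
    rw [hb, ← b.repr_apply_apply, LinearIsometryEquiv.norm_map, EuclideanSpace.real_norm_sq_eq,
      Finset.prod_mul_distrib, ← Real.exp_sum]
    simp [Finset.mul_sum, mul_comm]
  rw [stdGaussian_eq_map_pi_orthonormalBasis b, integral_map
    (Measurable.aemeasurable (by fun_prop)) (by fun_prop)]
  simp_rw [hint]
  rw [integral_fintype_prod_eq_prod (f := fun i (y : ℝ) =>
    (if i = i₀ then |y| else 1) * Real.exp (-(s * y ^ 2)))]
  -- The factor at `i₀` is split into two half powers, so that one half power is common to all `i`.
  have hi : ∀ i, ∫ y, (if i = i₀ then |y| else 1) * Real.exp (-(s * y ^ 2)) ∂gaussianReal 0 1 =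
      (if i = i₀ then √(2 / Real.pi) * (1 / (1 + 2 * s)) ^ (1 / 2 : ℝ) else 1) *
        (1 / (1 + 2 * s)) ^ (1 / 2 : ℝ) := by
    intro i
    split_ifs with h
    · rw [integral_abs_mul_exp_neg_mul_sq_gaussianReal hs, mul_assoc,
        ← Real.rpow_add (by positivity)]
      norm_num
    · simp_rw [one_mul]
      rw [integral_exp_neg_mul_sq_gaussianReal hs, one_div (1 + 2 * s),
        Real.inv_rpow (by positivity), Real.rpow_neg (by positivity)]
  simp_rw [hi, Finset.prod_mul_distrib]
  rw [Finset.prod_ite_eq' , if_pos (Finset.mem_univ _), Finset.prod_const, mul_assoc,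
    ← Real.rpow_mul_natCast (by positivity), ← Real.rpow_add (by positivity), Finset.card_univ]
  congr 2
  ring

lemma lintegral_abs_inner_mul_exp_stdGaussian [Nonempty ι] {u : EuclideanSpace ℝ ι}
    (hu : ‖u‖ = 1) {s : ℝ} (hs : 0 < s) :
    ∫⁻ x, ENNReal.ofReal (|inner ℝ u x| * Real.exp (-(‖x‖ ^ 2 * s)))
        ∂stdGaussian (EuclideanSpace ℝ ι) =
      ENNReal.ofReal
        (√(2 / Real.pi) * (1 / (1 + 2 * s)) ^ (((Fintype.card ι : ℝ) + 1) / 2)) := by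
  have hpos : 0 < √(2 / Real.pi) * (1 / (1 + 2 * s)) ^ (((Fintype.card ι : ℝ) + 1) / 2) := by
    have := Real.pi_pos
    positivity
  rw [← integral_abs_inner_mul_exp_stdGaussian hu hs] at hpos ⊢
  refine (ofReal_integral_eq_lintegral_ofReal ?_ (ae_of_all _ fun x => by positivity)).symm
  by_contra h
  exact hpos.ne' (integral_undef h)

/-- The Beta-type integral `∫ s^(-1/2) (1+2s)^(-k) ds`, up to the factor `Γ(k)`. -/
lemma lintegral_rpow_mul_one_div_rpow {k : ℝ} (hk : 1 / 2 < k) :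
    ∫⁻ s in Set.Ioi (0 : ℝ), ENNReal.ofReal (s ^ (1 / 2 - 1 : ℝ)) *
        ENNReal.ofReal ((1 / (1 + 2 * s)) ^ k * Real.Gamma k) =
      ENNReal.ofReal (√(1 / 2) * Real.Gamma (1 / 2) * Real.Gamma (k - 1 / 2)) := by
  -- Expand `(1+2s)^(-k) Γ(k)` as a Gamma integral in `r` and swap; integrating out `s` leaves
  -- `r^(-1/2)`, which shifts `k` to `k - 1/2`.
  calc
    _ = ∫⁻ s in Set.Ioi (0 : ℝ), ∫⁻ r in Set.Ioi (0 : ℝ), ENNReal.ofReal (s ^ (1 / 2 - 1 : ℝ)) *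
        ENNReal.ofReal (r ^ (k - 1) * Real.exp (-((1 + 2 * s) * r))) := by
      refine setLIntegral_congr_fun measurableSet_Ioi fun s hs => ?_
      have hs : 0 < s := hs
      rw [← lintegral_rpow_mul_exp_neg_mul_Ioi (by linarith) (by positivity),
        lintegral_const_mul _ (by fun_prop)]
    _ = ∫⁻ r in Set.Ioi (0 : ℝ), ∫⁻ s in Set.Ioi (0 : ℝ), ENNReal.ofReal (s ^ (1 / 2 - 1 : ℝ)) *
        ENNReal.ofReal (r ^ (k - 1) * Real.exp (-((1 + 2 * s) * r))) :=
      lintegral_lintegral_swap (by fun_prop)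
    _ = ∫⁻ r in Set.Ioi (0 : ℝ), ENNReal.ofReal (√(1 / 2) * Real.Gamma (1 / 2)) *
        ENNReal.ofReal (r ^ (k - 1 / 2 - 1) * Real.exp (-(1 * r))) := by
      refine setLIntegral_congr_fun measurableSet_Ioi fun r hr => ?_
      have hr : 0 < r := hr
      have h : ∀ s ∈ Set.Ioi (0 : ℝ), ENNReal.ofReal (s ^ (1 / 2 - 1 : ℝ)) *
          ENNReal.ofReal (r ^ (k - 1) * Real.exp (-((1 + 2 * s) * r))) =
          ENNReal.ofReal (r ^ (k - 1) * Real.exp (-r)) *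
            ENNReal.ofReal (s ^ (1 / 2 - 1 : ℝ) * Real.exp (-(2 * r * s))) := by
        intro s hs
        have hs : 0 < s := hs
        rw [← ENNReal.ofReal_mul (by positivity), ← ENNReal.ofReal_mul (by positivity),
          show -((1 + 2 * s) * r) = -r + -(2 * r * s) by ring, Real.exp_add]
        ring_nf
      rw [setLIntegral_congr_fun measurableSet_Ioi h, lintegral_const_mul _ (by fun_prop),
        lintegral_rpow_mul_exp_neg_mul_Ioi (by norm_num) (by positivity),
        ← ENNReal.ofReal_mul (by positivity), ← ENNReal.ofReal_mul
          (mul_nonneg (by positivity) (Real.Gamma_pos_of_pos (by norm_num)).le)]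
      congr 1
      rw [show k - 1 / 2 - 1 = (k - 1) + -(1 / 2) by ring, Real.rpow_add hr, one_mul,
        Real.rpow_neg hr.le, ← Real.inv_rpow hr.le, Real.sqrt_eq_rpow,
        show 1 / (2 * r) = 1 / 2 * r⁻¹ by field_simp,
        Real.mul_rpow (x := 1 / 2) (by norm_num) (by positivity)]
      ring
    _ = _ := by
      rw [lintegral_const_mul _ (by fun_prop),
        lintegral_rpow_mul_exp_neg_mul_Ioi (by linarith) one_pos, ← ENNReal.ofReal_mul
          (mul_nonneg (by positivity) (Real.Gamma_pos_of_pos (by norm_num)).le)]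
      simp

/-- The mean of `|cos|` of the angle between a fixed direction and a standard Gaussian vector. -/
theorem lintegral_abs_inner_div_norm_stdGaussian [Nonempty ι] {u : EuclideanSpace ℝ ι}
    (hu : ‖u‖ = 1) :
    ∫⁻ x, ENNReal.ofReal (|inner ℝ u x| / ‖x‖) ∂stdGaussian (EuclideanSpace ℝ ι) =
      ENNReal.ofReal (betaConst (Fintype.card ι)) := by
  set k : ℝ := ((Fintype.card ι : ℝ) + 1) / 2 with hk
  have hcard : (0 : ℝ) < Fintype.card ι := by exact_mod_cast Fintype.card_pos
  have hΓk : 0 < Real.Gamma k := Real.Gamma_pos_of_pos (by positivity)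
  have hΓ2 : 0 < Real.Gamma (1 / 2) := Real.Gamma_pos_of_pos (by norm_num)
  have hΓD : 0 < Real.Gamma ((Fintype.card ι : ℝ) / 2) := Real.Gamma_pos_of_pos (by positivity)
  have hπ := Real.pi_pos
  -- `Γ(1/2)` pays for the integral form of `1 / ‖x‖`, and `Γ(k)` for that of `(1+2s)^(-k)`.
  have key : ENNReal.ofReal (Real.Gamma k * Real.Gamma (1 / 2)) *
      ∫⁻ x, ENNReal.ofReal (|inner ℝ u x| / ‖x‖) ∂stdGaussian (EuclideanSpace ℝ ι) =
      ENNReal.ofReal (Real.Gamma k * Real.Gamma (1 / 2)) *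
        ENNReal.ofReal (betaConst (Fintype.card ι)) := by
    calc
      _ = ENNReal.ofReal (Real.Gamma k) * ∫⁻ x, (∫⁻ s in Set.Ioi (0 : ℝ),
          ENNReal.ofReal (s ^ (1 / 2 - 1 : ℝ)) *
          ENNReal.ofReal (|inner ℝ u x| * Real.exp (-(‖x‖ ^ 2 * s))))
            ∂stdGaussian (EuclideanSpace ℝ ι) := by
        rw [ENNReal.ofReal_mul hΓk.le, mul_assoc, ← lintegral_const_mul _ (by fun_prop)]
        congr 1
        refine lintegral_congr fun x => ?_
        have h : ∀ s ∈ Set.Ioi (0 : ℝ), ENNReal.ofReal (s ^ (1 / 2 - 1 : ℝ)) *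
            ENNReal.ofReal (|inner ℝ u x| * Real.exp (-(‖x‖ ^ 2 * s))) =
            ENNReal.ofReal |inner ℝ u x| *
              ENNReal.ofReal (s ^ (1 / 2 - 1 : ℝ) * Real.exp (-(‖x‖ ^ 2 * s))) := by
          intro s hs
          have hs : 0 < s := hs
          rw [← ENNReal.ofReal_mul (by positivity), ← ENNReal.ofReal_mul (by positivity)]
          ring_nf
        rw [setLIntegral_congr_fun measurableSet_Ioi h, lintegral_const_mul _ (by fun_prop)]
        -- At `x = 0` both sides vanish, by `0 / 0 = 0` and `0 * ∞ = 0`.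
        rcases eq_or_ne x 0 with rfl | hx
        · simp
        have hx' : 0 < ‖x‖ := norm_pos_iff.2 hx
        rw [lintegral_rpow_mul_exp_neg_mul_Ioi (by norm_num) (by positivity),
          ← ENNReal.ofReal_mul hΓ2.le, ← ENNReal.ofReal_mul (by positivity), ← Real.sqrt_eq_rpow,
          Real.sqrt_div zero_le_one, Real.sqrt_sq hx'.le, Real.sqrt_one]
        congr 1
        ring
      _ = ENNReal.ofReal (Real.Gamma k) * ∫⁻ s in Set.Ioi (0 : ℝ), ∫⁻ x,
          ENNReal.ofReal (s ^ (1 / 2 - 1 : ℝ)) *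
          ENNReal.ofReal (|inner ℝ u x| * Real.exp (-(‖x‖ ^ 2 * s)))
            ∂stdGaussian (EuclideanSpace ℝ ι) := by
        rw [lintegral_lintegral_swap (by fun_prop)]
      _ = ∫⁻ s in Set.Ioi (0 : ℝ), ENNReal.ofReal √(2 / Real.pi) *
          (ENNReal.ofReal (s ^ (1 / 2 - 1 : ℝ)) *
            ENNReal.ofReal ((1 / (1 + 2 * s)) ^ k * Real.Gamma k)) := by
        rw [← lintegral_const_mul' _ _ ENNReal.ofReal_ne_top]
        refine setLIntegral_congr_fun measurableSet_Ioi fun s hs => ?_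
        have hs : 0 < s := hs
        rw [lintegral_const_mul _ (by fun_prop), lintegral_abs_inner_mul_exp_stdGaussian hu hs,
          ← hk, ← ENNReal.ofReal_mul (by positivity), ← ENNReal.ofReal_mul hΓk.le,
          ← ENNReal.ofReal_mul (by positivity), ← ENNReal.ofReal_mul (by positivity)]
        congr 1
        ring
      _ = _ := by
        rw [lintegral_const_mul' _ _ ENNReal.ofReal_ne_top,
          lintegral_rpow_mul_one_div_rpow (by rw [hk]; linarith),
          ← ENNReal.ofReal_mul (by positivity), ← ENNReal.ofReal_mul (by positivity)]
        congr 1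
        have h2 : √2 ≠ 0 := by positivity
        rw [betaConst, ← hk, show k - 1 / 2 = (Fintype.card ι : ℝ) / 2 by rw [hk]; ring,
          Real.sqrt_div (by norm_num), Real.sqrt_div (by norm_num), Real.sqrt_one]
        field_simp
  exact (ENNReal.mul_right_inj (ENNReal.ofReal_pos.2 (by positivity)).ne'
    ENNReal.ofReal_ne_top).1 key

end StdGaussian

/-! ### Transfer to matrices with the Frobenius inner product -/

section Matrix

variable {m n : ℕ}

/-- The entries of a matrix as a vector of Euclidean space. -/
def matrixToEuclidean (X : Matrix (Fin m) (Fin n) ℝ) : EuclideanSpace ℝ (Fin m × Fin n) :=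
  WithLp.toLp 2 fun p => X p.1 p.2

lemma frobInner_eq_sum (X Y : Matrix (Fin m) (Fin n) ℝ) :
    frobInner X Y = ∑ p : Fin m × Fin n, X p.1 p.2 * Y p.1 p.2 := by
  rw [Fintype.sum_prod_type, Finset.sum_comm]
  simp [frobInner, Matrix.trace, Matrix.mul_apply]

lemma frobInner_eq_inner (X Y : Matrix (Fin m) (Fin n) ℝ) :
    frobInner X Y = inner ℝ (matrixToEuclidean X) (matrixToEuclidean Y) := by
  simp [frobInner_eq_sum, matrixToEuclidean, PiLp.inner_apply, mul_comm]

lemma frobNorm_eq_norm (X : Matrix (Fin m) (Fin n) ℝ) : frobNorm X = ‖matrixToEuclidean X‖ := by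
  rw [frobNorm, frobInner_eq_inner, real_inner_self_eq_norm_sq, Real.sqrt_sq (norm_nonneg _)]

lemma frobNorm_pos {X : Matrix (Fin m) (Fin n) ℝ} (hX : X ≠ 0) : 0 < frobNorm X := by
  rw [frobNorm_eq_norm, norm_pos_iff]
  contrapose! hX
  ext i j
  simpa [matrixToEuclidean] using congr($hX (i, j))

lemma matrixToEuclidean_smul (c : ℝ) (X : Matrix (Fin m) (Fin n) ℝ) :
    matrixToEuclidean (c • X) = c • matrixToEuclidean X := rfl

lemma cosSim_mezoNoiseless {G : Matrix (Fin m) (Fin n) ℝ} (hG : G ≠ 0)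
    (X : Matrix (Fin m) (Fin n) ℝ) :
    cosSim (mezoNoiseless G X) G =
      |inner ℝ ((frobNorm G)⁻¹ • matrixToEuclidean G) (matrixToEuclidean X)| /
        ‖matrixToEuclidean X‖ := by
  have hG' := frobNorm_pos hG
  rw [cosSim, mezoNoiseless, frobNorm_eq_norm (_ • _), frobInner_eq_inner (_ • _),
    matrixToEuclidean_smul, norm_smul, real_inner_smul_left, real_inner_smul_left,
    real_inner_comm, ← frobInner_eq_inner, Real.norm_eq_abs, abs_mul, abs_inv, abs_of_pos hG',
    ← abs_mul_abs_self (frobInner G X)]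
  -- If `X` is orthogonal to `G`, the estimator is `0` and its cosine is `0` by the convention for
  -- division by zero.
  rcases eq_or_ne (frobInner G X) 0 with h | h
  · simp [h]
  have := abs_pos.2 h
  field_simp

lemma IsStdGaussianMatrix.hasLaw {Ω : Type*} [MeasurableSpace Ω] {P : Measure Ω}
    [IsProbabilityMeasure P] {R : Ω → Matrix (Fin m) (Fin n) ℝ} (hR : IsStdGaussianMatrix P R) :
    HasLaw (fun ω => matrixToEuclidean (R ω))
      (stdGaussian (EuclideanSpace ℝ (Fin m × Fin n))) P := by
  have hmeas : ∀ p : Fin m × Fin n, AEMeasurable (fun ω => R ω p.1 p.2) P :=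
    fun p => (hR.1 p.1 p.2).aemeasurable
  have hmeas' : AEMeasurable (fun ω (p : Fin m × Fin n) => R ω p.1 p.2) P :=
    aemeasurable_pi_lambda _ hmeas
  have hlp : Measurable (WithLp.toLp 2 : (Fin m × Fin n → ℝ) → EuclideanSpace ℝ _) := by fun_prop
  refine ⟨hlp.comp_aemeasurable hmeas', ?_⟩
  have h := (iIndepFun_iff_map_fun_eq_pi_map hmeas).1 hR.2
  simp_rw [fun p : Fin m × Fin n => (hR.1 p.1 p.2).map_eq] at h
  rw [← map_pi_eq_stdGaussian, ← h, AEMeasurable.map_map_of_aemeasurable hlp.aemeasurable hmeas']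
  rfl

lemma betaConst_nonneg (D : ℕ) : 0 ≤ betaConst D :=
  div_nonneg (Real.Gamma_nonneg_of_nonneg (by positivity))
    (mul_nonneg (Real.sqrt_nonneg _) (Real.Gamma_nonneg_of_nonneg (by positivity)))

lemma tendsto_mezoEstimator {f : Matrix (Fin m) (Fin n) ℝ → ℝ} {G W : Matrix (Fin m) (Fin n) ℝ}
    (hf : HasMatrixGradientAt f G W) (X : Matrix (Fin m) (Fin n) ℝ) :
    Tendsto (fun μ : ℝ => mezoEstimator f W μ X) (𝓝[>] 0) (𝓝 (mezoNoiseless G X)) := by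
  refine Tendsto.smul_const ?_ X
  have h := (hasDerivAt_iff_tendsto_slope_zero.1 (hf X)).mono_left
    (nhdsWithin_mono (s := Set.Ioi 0) _ fun x (hx : 0 < x) => hx.ne')
  simpa [div_eq_inv_mul] using h

lemma lintegral_cosSim_mezoNoiseless {G : Matrix (Fin m) (Fin n) ℝ} (hG : G ≠ 0)
    {Ω : Type*} [MeasurableSpace Ω] {P : Measure Ω} [IsProbabilityMeasure P]
    {R : Ω → Matrix (Fin m) (Fin n) ℝ} (hR : IsStdGaussianMatrix P R) :
    ∫⁻ ω, ENNReal.ofReal (cosSim (mezoNoiseless G (R ω)) G) ∂P =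
      ENNReal.ofReal (betaConst (m * n)) := by
  have : Nonempty (Fin m × Fin n) := by
    by_contra h
    rw [not_nonempty_iff] at h
    exact hG (Matrix.ext fun i j => h.elim (i, j))
  have hG' := frobNorm_pos hG
  have hu : ‖(frobNorm G)⁻¹ • matrixToEuclidean G‖ = 1 := by
    rw [norm_smul, ← frobNorm_eq_norm, norm_inv, Real.norm_of_nonneg hG'.le,
      inv_mul_cancel₀ hG'.ne']
  have h := lintegral_abs_inner_div_norm_stdGaussian hu
  rw [← hR.hasLaw.map_eq, lintegral_map' (by fun_prop) hR.hasLaw.aemeasurable] at h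
  simpa [cosSim_mezoNoiseless hG] using h

end Matrix

theorem corollary2 (dout din : ℕ) (G : Matrix (Fin dout) (Fin din) ℝ) (hG : G ≠ 0)
    {Ω : Type*} [MeasurableSpace Ω] (P : Measure Ω) [IsProbabilityMeasure P]
    (R : Ω → Matrix (Fin dout) (Fin din) ℝ) (hR : IsStdGaussianMatrix P R) :
    -- the noiseless estimator is the limit, as `μ → 0`, of the finite-difference estimator
    (∀ (f : Matrix (Fin dout) (Fin din) ℝ → ℝ) (W : Matrix (Fin dout) (Fin din) ℝ),
      HasMatrixGradientAt f G W → ∀ ω,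
        Tendsto (fun μ : ℝ => mezoEstimator f W μ (R ω)) (𝓝[>] 0)
          (𝓝 (mezoNoiseless G (R ω)))) ∧
    -- the expected cosine similarity
    (Integrable (fun ω => cosSim (mezoNoiseless G (R ω)) G) P ∧
      ∫ ω, cosSim (mezoNoiseless G (R ω)) G ∂P = betaConst (dout * din)) ∧
    -- this is the special case `A = I` of the noiseless AGZO estimator
    ((1 : Matrix (Fin din) (Fin din) ℝ).transpose * (1 : Matrix (Fin din) (Fin din) ℝ) = 1 ∧
      (∀ ω, mezoNoiseless G (R ω) = agzoNoiseless G 1 (R ω)) ∧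
      frobNorm (G * (1 : Matrix (Fin din) (Fin din) ℝ)) / frobNorm G = 1) := by
  refine ⟨fun f W hf ω => tendsto_mezoEstimator hf (R ω), ?_, by simp, ?_, ?_⟩
  · have hnonneg : ∀ ω, 0 ≤ cosSim (mezoNoiseless G (R ω)) G := fun ω => by
      rw [cosSim_mezoNoiseless hG]
      positivity
    have hmeas : AEStronglyMeasurable (fun ω => cosSim (mezoNoiseless G (R ω)) G) P := by
      simp_rw [cosSim_mezoNoiseless hG]
      have h : Measurable fun x : EuclideanSpace ℝ (Fin dout × Fin din) =>
          |inner ℝ ((frobNorm G)⁻¹ • matrixToEuclidean G) x| / ‖x‖ := by fun_prop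
      exact (h.comp_aemeasurable hR.hasLaw.aemeasurable).aestronglyMeasurable
    have hl := lintegral_cosSim_mezoNoiseless hG hR
    refine ⟨⟨hmeas, ?_⟩, ?_⟩
    · rw [hasFiniteIntegral_iff_ofReal (ae_of_all _ hnonneg), hl]
      exact ENNReal.ofReal_lt_top
    · rw [integral_eq_lintegral_of_nonneg_ae (ae_of_all _ hnonneg) hmeas, hl,
        ENNReal.toReal_ofReal (betaConst_nonneg _)]
  · intro ω
    simp [mezoNoiseless, agzoNoiseless]
  · rw [Matrix.mul_one, div_self (frobNorm_pos hG).ne']
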